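/- Let $T = C_1 * \dots * C_n$ be a free product of finitely many non-trivial cyclic groups (finite or infinite), with $n \ge 2$, other than $\mathbb{Z}_2 * \mathbb{Z}_2$ (that is, it is not the case that $n = 2$ and both factors have order $2$). Let $\Gamma$ be a finite group. For $d \in \mathbb{N}$, let $F(T,\Gamma,d)$ be the set of conjugacy classes in $T$ of free subgroups $H \le T$ of finite index $\le d$ such that $N_T(H)/H \cong \Gamma$, where $N_T(H)$ is the normaliser of $H$ in $T$. Then $F(T,\Gamma,d)$ is finite for every $d$, and: 1. there exist constants $A > 1$, $B > 0$ and $M \in \mathbb{N}$ (depending only on $T$ and $\Gamma$) such that $|F(T,\Gamma,d)| \ge A^{B d \log d}$ for all $d \ge M$; 2. there exist constants $C > 1$, $D > 0$ and $M' \in \mathbb{N}$ (depending only on $T$ and $\Gamma$) such that $|F(T,\Gamma,d)| \le C^{D d \log d}$ for all $d \ge M'$. Consequently $|F(T,\Gamma,d)|$ has growth type $d^d$: there are constants $A_1, B_1, A_2, B_2 > 0$ such that $A_1 d^{B_1 d} \le |F(T,\Gamma,d)| \le A_2 d^{B_2 d}$ for all sufficiently large $d$. -/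

import Mathlib

/-- The conjugacy class `{g H g⁻¹ | g ∈ T}` of a subgroup `H` of `T`. -/
def conjClassOf {T : Type*} [Group T] (H : Subgroup T) : Set (Subgroup T) :=
  {K | ∃ g : T, K = H.map (MulAut.conj g).toMonoidHom}

/-- The subgroup `H` of `T` is free, has finite index at most `d`, and `N_T(H) / H ≅ Γ`. -/
def IsFreeWithSymmetry {T : Type*} [Group T] (Γ : Type*) [Group Γ] (d : ℕ)
    (H : Subgroup T) : Prop :=
  IsFreeGroup H ∧ H.FiniteIndex ∧ H.index ≤ d ∧
    Nonempty ((Subgroup.normalizer (H : Set T) ⧸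
      H.subgroupOf (Subgroup.normalizer (H : Set T))) ≃* Γ)

/-- The set `F(T, Γ, d)` of free subgroups `H` of `T` of index at most `d` with
`N_T(H) / H ≅ Γ`, up to conjugacy in `T`: its elements are the conjugacy classes. -/
def freeSymmetryClasses (T : Type*) [Group T] (Γ : Type*) [Group Γ] (d : ℕ) :
    Set (Set (Subgroup T)) :=
  conjClassOf '' {H : Subgroup T | IsFreeWithSymmetry Γ d H}

/-- The function `f` has growth type `d ^ d`: for all sufficiently large `d`, it lies between
`A₁ d ^ (B₁ d)` and `A₂ d ^ (B₂ d)`, for suitable positive constants. -/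
def HasGrowthTypeSelfPow (f : ℕ → ℝ) : Prop :=
  ∃ A₁ B₁ A₂ B₂ : ℝ, 0 < A₁ ∧ 0 < B₁ ∧ 0 < A₂ ∧ 0 < B₂ ∧ ∃ M : ℕ, ∀ d : ℕ, M ≤ d →
    A₁ * (d : ℝ) ^ (B₁ * d) ≤ f d ∧ f d ≤ A₂ * (d : ℝ) ^ (B₂ * d)

/-! Upper bound: a subgroup of index at most `d` is a point stabilizer of an action of `T` on `d`
points, and an action is determined by the images of the cyclic generators.

Lower bound: map the factors to a finite group `Q`, injectively on finite factors, and let `T` act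
on `Q × Q × (ZMod N × Γ)`. One factor translates the first coordinate, conjugated by permutations of
the fibres ("voltages"); the others translate the second. Finite factors act freely, so point
stabilizers are free by a Kurosh-type argument (`Monoid.CoprodI.isFreeGroup_of_isCyclic`).
Commutators of factor elements go round squares in `Q × Q` and act on the fibre over `(1, 1)` by the
inverses of chosen voltages: one a shift `u`, the other a lift `v` of a permutation `σ` of `ZMod N`
with labels in `Γ`. Right multiplication by `Γ` commutes with the action. If `σ` is rigid,
membership conditions on `u` and `v` single out the `Γ`-orbit of the base point
(`exists_of_isMarked`), so the stabilizer `H` has `N(H)/H ≅ Γ`. Words in `u` and `v` recover `σ`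
from `H`, so different `σ` give different conjugacy classes. There are at least `M!` rigid
permutations for `N = 2M + 6`, and the index is linear in `M`; Stirling-type estimates finish.
Excluding `ℤ₂ * ℤ₂` provides the two distinct nontrivial elements needed for `u` and `v`. -/

/-! ### Freeness of subgroups through cocycles on the action groupoid -/

/-- A crossed homomorphism (cocycle) of a group `G` acting on `A` with values in a group `X`. -/
def IsActionCocycle {G A X : Type*} [Group G] [MulAction G A] [Group X] (c : G → A → X) : Prop :=
  ∀ g h b, c (g * h) b = c g b * c h (g⁻¹ • b)

namespace IsActionCocycle

variable {G A X : Type*} [Group G] [MulAction G A] [Group X]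

theorem map_one {c : G → A → X} (hc : IsActionCocycle c) (b : A) : c 1 b = 1 := by
  have := hc 1 1 b
  simpa using this

/-- The homomorphism to the semidirect product attached to a cocycle. -/
def toHom {c : G → A → X} (hc : IsActionCocycle c) : G →* (A → X) ⋊[mulAutArrow] G :=
  MonoidHom.mk' (fun g => ⟨c g, g⟩) (by
    intro g h
    ext b
    · exact hc g h b
    · rfl)

theorem of_hom {F : G →* (A → X) ⋊[mulAutArrow] G} (hF : ∀ g, (F g).right = g) :
    IsActionCocycle fun g => (F g).left := by
  intro g h b
  change (F (g * h)).left b = _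
  rw [_root_.map_mul, SemidirectProduct.mul_left, Pi.mul_apply, hF]
  rfl

end IsActionCocycle

/-- The arrows `(t e, g e)` of the action groupoid of `G` on `A` freely generate it: cocycles are
uniquely determined by their arbitrary values on these arrows. -/
def FreelyGeneratesCocycles.{u, v, w, z} {G : Type u} {A : Type v} [Group G] [MulAction G A]
    {E : Type w} (g : E → G) (t : E → A) : Prop :=
  ∀ (X : Type z) [Group X] (f : E → X),
    ∃! c : G → A → X, IsActionCocycle c ∧ ∀ e, c (g e) (t e) = f e

theorem isFreeGroup_of_bijective {F K : Type*} [Group F] [Group K] [IsFreeGroup F] (φ : F → K)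
    (hφ : Function.Bijective φ) (hmul : ∀ a b, φ (a * b) = φ a * φ b) : IsFreeGroup K :=
  IsFreeGroup.ofMulEquiv (MulEquiv.ofBijective (MonoidHom.mk' φ hmul) hφ)

section Groupoid

open CategoryTheory CategoryTheory.ActionCategory

universe u

/-- The action groupoid is free when cocycles are freely generated. -/
@[reducible]
noncomputable def isFreeGroupoidOfFreelyGeneratesCocycles {G A E : Type u} [Group G]
    [MulAction G A] {g : E → G} {t : E → A}
    (h : FreelyGeneratesCocycles.{u, u, u, u} g t) : IsFreeGroupoid (ActionCategory G A) where
  quiverGenerators := ⟨fun a b => { e : E // g e • a.back = b.back ∧ t e = b.back }⟩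
  of := fun (e : Subtype _) => ⟨g e, e.property.1⟩
  unique_lift := by
    intro X _ f
    let f' : E → X := fun e => @f ⟨(), (g e)⁻¹ • t e⟩ ⟨(), t e⟩ ⟨e, smul_inv_smul _ _, rfl⟩
    obtain ⟨c, ⟨hc, hf⟩, uc⟩ := h X f'
    refine ⟨uncurry hc.toHom (fun _ => rfl), ?_, ?_⟩
    · rintro ⟨⟨⟩, a : A⟩ ⟨⟨⟩, b⟩ ⟨e, h1 : g e • a = b, h2 : t e = b⟩
      subst h2
      obtain rfl := inv_smul_eq_iff.mpr h1.symm
      exact hf e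
    · intro F hF
      have key : (fun k => (curry F k).left) = c := by
        apply uc
        refine ⟨IsActionCocycle.of_hom fun _ => rfl, fun e => ?_⟩
        exact hF ⟨(), (g e)⁻¹ • t e⟩ ⟨(), t e⟩ ⟨e, smul_inv_smul _ _, rfl⟩
      apply Functor.hext
      · intro
        apply Unit.ext
      · refine ActionCategory.cases ?_
        intro b k
        have := congrFun (congrFun key k) b
        apply heq_of_eq
        exact this

/-- `H` is a vertex group of the connected action groupoid on `G ⧸ H`, and vertex groups of a
connected free groupoid are free. -/
theorem isFreeGroup_of_freelyGeneratesCocycles {G E : Type u} [Group G] (H : Subgroup G)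
    {g : E → G} {t : E → G ⧸ H} (h : FreelyGeneratesCocycles.{u, u, u, u} g t) :
    IsFreeGroup H := by
  let _ : IsFreeGroupoid (ActionCategory G (G ⧸ H)) := isFreeGroupoidOfFreelyGeneratesCocycles h
  let e := endMulEquivSubgroup H
  have hconn : IsConnected (ActionCategory G (G ⧸ H)) := inferInstance
  have hfree := @IsFreeGroupoid.endIsFreeOfConnectedFree (ActionCategory G (G ⧸ H)) _ hconn _
    (objEquiv G (G ⧸ H) ↑(1 : G))
  exact @isFreeGroup_of_bijective _ _ _ _ hfree e e.bijective fun a b => e.map_mul a b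

end Groupoid

/-- A free action has freely generated cocycles: use the arrows from a chosen point of each orbit
to the other points of that orbit. -/
theorem exists_freelyGeneratesCocycles_of_free.{u, v, z} {G : Type u} {A : Type v} [Group G]
    [MulAction G A] (hfree : ∀ (g : G) (a : A), g • a = a → g = 1) :
    ∃ (E : Set A) (g : E → G) (t : E → A), FreelyGeneratesCocycles.{u, v, v, z} g t := by
  classical
  let root : A → A := fun a => (Quotient.mk (MulAction.orbitRel G A) a).out
  have hroot : ∀ a, ∃ g : G, g • root a = a := fun a => by
    have : MulAction.orbitRel G A (root a) a := Quotient.exact (Quotient.out_eq _)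
    obtain ⟨g, hg⟩ := (MulAction.orbitRel G A).symm this
    exact ⟨g, hg⟩
  have root_smul : ∀ (g : G) a, root (g • a) = root a := fun g a => by
    have : Quotient.mk (MulAction.orbitRel G A) (g • a) = Quotient.mk _ a :=
      Quotient.sound ⟨g, rfl⟩
    simp only [root, this]
  choose γ hγ using hroot
  have huniq : ∀ (g h : G) (a : A), g • a = h • a → g = h := fun g h a hgh => by
    have := hfree (h⁻¹ * g) a (by rw [mul_smul, hgh, inv_smul_smul])
    rwa [inv_mul_eq_one, eq_comm] at this
  refine ⟨{b | b ≠ root b}, fun e => γ e, fun e => e, fun X _ f => ?_⟩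
  -- A potential, equal to `1` at the roots. Since the action is free, every cocycle is the
  -- coboundary of its potential.
  let d : A → X := fun b => if h : b ≠ root b then f ⟨b, h⟩ else 1
  have root_root : ∀ b, root (root b) = root b := fun b => by
    conv_rhs => rw [← hγ b]
    rw [root_smul]
  have d_root : ∀ b, d (root b) = 1 := fun b => dif_neg (by rw [root_root]; simp)
  refine ⟨fun g b => d b * (d (g⁻¹ • b))⁻¹, ⟨fun g h b => ?_, fun e => ?_⟩, ?_⟩
  · simp [mul_smul, mul_assoc]
  · obtain ⟨e, he⟩ := e
    have h1 : (γ e)⁻¹ • e = root e := by rw [inv_smul_eq_iff, hγ]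
    change d e * (d ((γ e)⁻¹ • e))⁻¹ = _
    rw [h1, d_root, inv_one, mul_one]
    exact dif_pos he
  · rintro c ⟨hc, hf⟩
    have hd : ∀ b, c (γ b) b = d b := fun b => by
      by_cases h : b ≠ root b
      · exact (hf ⟨b, h⟩).trans (dif_pos h : d b = f ⟨b, h⟩).symm
      · have h1 : γ b = 1 := huniq _ _ (root b) (by rw [hγ, one_smul]; exact not_not.mp h)
        rw [h1, hc.map_one]
        exact (dif_neg h : d b = 1).symm
    funext g b
    have h1 : g * γ (g⁻¹ • b) = γ b := by
      apply huniq _ _ (root b)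
      rw [hγ, mul_smul]
      conv_lhs => rw [← root_smul g⁻¹ b, hγ, smul_inv_smul]
    have h2 := hc g (γ (g⁻¹ • b)) b
    rw [h1, hd, hd] at h2
    rw [h2, mul_inv_cancel_right]

/-- Cocycles of an infinite cyclic group are freely generated by the arrows labelled by a
generator. -/
theorem exists_freelyGeneratesCocycles_of_infinite_cyclic.{u, v, z} {G : Type u} {A : Type v}
    [Group G] [IsCyclic G] [Infinite G] [MulAction G A] :
    ∃ (E : Set A) (g : E → G) (t : E → A), FreelyGeneratesCocycles.{u, v, v, z} g t := by
  obtain ⟨x, hx⟩ := IsCyclic.exists_generator (α := G)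
  have hx0 : orderOf x = 0 := by
    rw [orderOf_eq_card_of_forall_mem_zpowers hx, Nat.card_eq_zero_of_infinite]
  have hinj : Function.Injective fun n : ℤ => x ^ n :=
    injective_zpow_iff_not_isOfFinOrder.mpr (orderOf_eq_zero_iff.mp hx0)
  have hbij : Function.Bijective (zpowersHom G x) := by
    refine ⟨fun a b hab => ?_, fun g => ?_⟩
    · exact Multiplicative.toAdd.injective (hinj (by simpa using hab))
    · obtain ⟨n, hn⟩ := hx g
      exact ⟨Multiplicative.ofAdd n, by simpa using hn⟩
  let e := MulEquiv.ofBijective _ hbij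
  have he : e.symm x = Multiplicative.ofAdd 1 := by
    rw [MulEquiv.symm_apply_eq]; simp [e]
  refine ⟨Set.univ, fun _ => x, fun b => b, fun X _ f => ?_⟩
  let F : G →* (A → X) ⋊[mulAutArrow] G :=
    (zpowersHom _ (⟨fun a => f ⟨a, trivial⟩, x⟩ : (A → X) ⋊[mulAutArrow] G)).comp
      e.symm.toMonoidHom
  have hext : ∀ {K : Type _} [Group K] (p q : G →* K), p x = q x → p = q := by
    intro K _ p q h
    ext g
    obtain ⟨n, rfl⟩ := hx g
    simp [h]
  have hFx : F x = ⟨fun a => f ⟨a, trivial⟩, x⟩ := by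
    simp [F, he]
  have hF : ∀ g, (F g).right = g := by
    intro g
    obtain ⟨n, rfl⟩ := hx g
    have : (SemidirectProduct.rightHom (F (x ^ n))) = x ^ n := by
      rw [map_zpow, map_zpow, hFx]; rfl
    exact this
  refine ⟨fun g => (F g).left, ⟨IsActionCocycle.of_hom hF, fun b => by simp only [hFx]⟩, ?_⟩
  rintro c ⟨hc, hf⟩
  have : hc.toHom = F := by
    apply hext
    rw [hFx]
    ext1
    · funext a
      exact hf ⟨a, trivial⟩
    · rfl
  funext g
  rw [← this]
  rfl

/-- Freely generating arrows for the factors of a free product freely generate the cocycles of the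
free product. -/
theorem Monoid.CoprodI.freelyGeneratesCocycles.{u, v, w, z} {ι : Type u} {G : ι → Type v}
    [∀ i, Group (G i)] {A : Type w} [MulAction (Monoid.CoprodI G) A] {E : ι → Type w}
    (g : ∀ i, E i → G i) (t : ∀ i, E i → A)
    (h : ∀ i, letI := MulAction.compHom A (Monoid.CoprodI.of : G i →* Monoid.CoprodI G)
      FreelyGeneratesCocycles.{v, w, w, z} (g i) (t i)) :
    FreelyGeneratesCocycles.{max u v, w, max u w, z}
      (E := Σ i, E i) (fun e => Monoid.CoprodI.of (g e.1 e.2)) (fun e => t e.1 e.2) := by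
  intro X _ f
  have h' := fun i => h i X (fun e => f ⟨i, e⟩)
  choose c hc uc using h'
  have hmul : ∀ i, ∀ x y : G i, ∀ b, c i (x * y) b =
      c i x b * c i y ((Monoid.CoprodI.of x : Monoid.CoprodI G)⁻¹ • b) := by
    intro i x y b
    rw [← map_inv]
    exact (hc i).1 x y b
  let F : Monoid.CoprodI G →* (A → X) ⋊[mulAutArrow] Monoid.CoprodI G :=
    Monoid.CoprodI.lift fun i => MonoidHom.mk' (fun x => ⟨c i x, Monoid.CoprodI.of x⟩) (by
      intro x y
      ext b
      · exact hmul i x y b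
      · simp)
  have hFof : ∀ i (x : G i), F (Monoid.CoprodI.of x) = ⟨c i x, Monoid.CoprodI.of x⟩ := by
    intro i x
    simp [F]
  have hF : ∀ g, (F g).right = g := by
    intro g
    have : SemidirectProduct.rightHom.comp F = MonoidHom.id _ := by
      ext i x
      simp [hFof]
    exact DFunLike.congr_fun this g
  refine ⟨fun g => (F g).left, ⟨IsActionCocycle.of_hom hF, fun e => ?_⟩, ?_⟩
  · simp only [hFof]
    exact (hc e.1).2 e.2
  · rintro c' ⟨hc', hf'⟩
    have : hc'.toHom = F := by
      apply Monoid.CoprodI.ext_hom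
      intro i
      ext1 x
      simp only [MonoidHom.comp_apply, hFof]
      have hci : (fun x : G i => c' (Monoid.CoprodI.of x)) = c i := by
        apply uc i
        refine ⟨fun x y b => ?_, fun e => hf' ⟨i, e⟩⟩
        have := hc' (Monoid.CoprodI.of x) (Monoid.CoprodI.of y) b
        rw [← map_mul, ← map_inv] at this
        exact this
      ext1
      · exact congrFun hci x
      · rfl
    funext g
    rw [← this]
    rfl

/-- A subgroup of a free product of cyclic groups that meets every conjugate of a finite factor
trivially is free. -/
theorem Monoid.CoprodI.isFreeGroup_of_isCyclic {ι : Type*} {G : ι → Type*} [∀ i, Group (G i)]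
    [∀ i, IsCyclic (G i)] (H : Subgroup (Monoid.CoprodI G))
    (h : ∀ i, Finite (G i) → ∀ (x : G i) (k : Monoid.CoprodI G),
      k⁻¹ * Monoid.CoprodI.of x * k ∈ H → x = 1) : IsFreeGroup H := by
  have key : ∀ i,
      letI := MulAction.compHom (Monoid.CoprodI G ⧸ H)
        (Monoid.CoprodI.of : G i →* Monoid.CoprodI G)
      ∃ (E : Set (Monoid.CoprodI G ⧸ H)) (g : E → G i) (t : E → Monoid.CoprodI G ⧸ H),
        FreelyGeneratesCocycles g t := by
    intro i
    let _ := MulAction.compHom (Monoid.CoprodI G ⧸ H)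
      (Monoid.CoprodI.of : G i →* Monoid.CoprodI G)
    -- The hypothesis says exactly that finite factors act freely on the cosets; infinite cyclic
    -- factors need no condition.
    rcases finite_or_infinite (G i) with hfin | hinf
    · apply exists_freelyGeneratesCocycles_of_free
      intro x a hxa
      obtain ⟨k, rfl⟩ := QuotientGroup.mk_surjective a
      apply h i hfin x k
      have h1 : ((Monoid.CoprodI.of x * k : Monoid.CoprodI G) : Monoid.CoprodI G ⧸ H) = k := hxa
      rw [eq_comm, QuotientGroup.eq] at h1
      rwa [mul_assoc]
    · exact exists_freelyGeneratesCocycles_of_infinite_cyclic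
  choose E g t hE using key
  exact isFreeGroup_of_freelyGeneratesCocycles H
    (Monoid.CoprodI.freelyGeneratesCocycles g t hE)

/-! ### Counting subgroups of bounded index -/

section UpperBound

/-- The stabilizer of the point `x` under the permutation representation `f`. -/
def permStabilizer {T X : Type*} [Group T] (f : T →* Equiv.Perm X) (x : X) : Subgroup T :=
  (MulAction.stabilizer (Equiv.Perm X) x).comap f

@[simp]
theorem mem_permStabilizer {T X : Type*} [Group T] {f : T →* Equiv.Perm X} {x : X} {g : T} :
    g ∈ permStabilizer f x ↔ f g x = x := Iff.rfl

/-- The action on the cosets of `H`, embedded in `Fin d` and extended by the identity. -/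
theorem exists_permStabilizer_eq {T : Type*} [Group T] {H : Subgroup T} (hH : H.FiniteIndex)
    {d : ℕ} (hd : H.index ≤ d) :
    ∃ (f : T →* Equiv.Perm (Fin d)) (x : Fin d), permStabilizer f x = H := by
  have : Finite (T ⧸ H) := Subgroup.finite_quotient_of_finiteIndex
  have := Fintype.ofFinite (T ⧸ H)
  obtain ⟨e⟩ : Nonempty ((T ⧸ H) ↪ Fin d) := by
    rw [Function.Embedding.nonempty_iff_card_le, Fintype.card_fin, ← Nat.card_eq_fintype_card]
    exact hd
  refine ⟨(Equiv.Perm.viaEmbeddingHom e).comp (MulAction.toPermHom T (T ⧸ H)),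
    e ((1 : T) : T ⧸ H), ?_⟩
  ext g
  rw [mem_permStabilizer, MonoidHom.comp_apply, Equiv.Perm.viaEmbeddingHom_apply,
    Equiv.Perm.viaEmbedding_apply, e.injective.eq_iff]
  change ((g * 1 : T) : T ⧸ H) = (1 : T) ↔ _
  rw [mul_one, eq_comm, QuotientGroup.eq, inv_one, one_mul]

theorem finite_setOf_index_le {ι : Type*} [Finite ι] {G : ι → Type*} [∀ i, Group (G i)]
    [∀ i, IsCyclic (G i)] (d : ℕ) :
    {H : Subgroup (Monoid.CoprodI G) | H.FiniteIndex ∧ H.index ≤ d}.Finite ∧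
      {H : Subgroup (Monoid.CoprodI G) | H.FiniteIndex ∧ H.index ≤ d}.ncard ≤
        d.factorial ^ Nat.card ι * d := by
  choose x hx using fun i => IsCyclic.exists_generator (α := G i)
  let res : (Monoid.CoprodI G →* Equiv.Perm (Fin d)) → ι → Equiv.Perm (Fin d) :=
    fun f i => f (Monoid.CoprodI.of (x i))
  have hres : Function.Injective res := by
    intro f f' hff
    apply Monoid.CoprodI.ext_hom
    intro i
    ext1 y
    obtain ⟨n, rfl⟩ := hx i y
    have := congrFun hff i
    simp only [res] at this
    simp [this]
  have hfin : Finite (Monoid.CoprodI G →* Equiv.Perm (Fin d)) := Finite.of_injective res hres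
  let code : (Monoid.CoprodI G →* Equiv.Perm (Fin d)) × Fin d → Subgroup (Monoid.CoprodI G) :=
    fun p => permStabilizer p.1 p.2
  have hsub : {H : Subgroup (Monoid.CoprodI G) | H.FiniteIndex ∧ H.index ≤ d} ⊆
      code '' Set.univ := by
    rintro H ⟨hH, hd⟩
    obtain ⟨f, y, rfl⟩ := exists_permStabilizer_eq hH hd
    exact ⟨(f, y), trivial, rfl⟩
  have hfin' : (code '' Set.univ).Finite := Set.finite_univ.image _
  refine ⟨hfin'.subset hsub, (Set.ncard_le_ncard hsub hfin').trans
    ((Set.ncard_image_le Set.finite_univ).trans ?_)⟩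
  rw [Set.ncard_univ, Nat.card_prod, Nat.card_fin]
  refine Nat.mul_le_mul_right _ ((Nat.card_le_card_of_injective res hres).trans ?_)
  rw [Nat.card_fun, Nat.card_perm, Nat.card_fin]

theorem freeSymmetryClasses_finite_and_ncard_le {ι : Type*} [Finite ι] {G : ι → Type*}
    [∀ i, Group (G i)] [∀ i, IsCyclic (G i)] (Γ : Type*) [Group Γ] (d : ℕ) :
    (freeSymmetryClasses (Monoid.CoprodI G) Γ d).Finite ∧
      (freeSymmetryClasses (Monoid.CoprodI G) Γ d).ncard ≤ d.factorial ^ Nat.card ι * d := by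
  obtain ⟨hfin, hcard⟩ := finite_setOf_index_le (G := G) d
  have hsub : {H : Subgroup (Monoid.CoprodI G) | IsFreeWithSymmetry Γ d H} ⊆
      {H : Subgroup (Monoid.CoprodI G) | H.FiniteIndex ∧ H.index ≤ d} :=
    fun H hH => ⟨hH.2.1, hH.2.2.1⟩
  exact ⟨(hfin.subset hsub).image _, (Set.ncard_image_le (hfin.subset hsub)).trans
    ((Set.ncard_le_ncard hsub hfin).trans hcard)⟩

end UpperBound

/-! ### Normalizers of point stabilizers -/

section Symmetry

theorem permStabilizer_conj {T X : Type*} [Group T] (f : T →* Equiv.Perm X) (x : X) (g : T) :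
    (permStabilizer f x).map (MulAut.conj g).toMonoidHom = permStabilizer f (f g x) := by
  ext k
  rw [Subgroup.mem_map_equiv, mem_permStabilizer, mem_permStabilizer, MulAut.conj_symm_apply,
    map_mul, map_mul, map_inv, Equiv.Perm.mul_apply, Equiv.Perm.mul_apply,
    Equiv.Perm.inv_eq_iff_eq, eq_comm, eq_comm (a := f g x)]

theorem permStabilizer_index_le {T X : Type*} [Group T] [Finite X] (f : T →* Equiv.Perm X)
    (x : X) : (permStabilizer f x).FiniteIndex ∧ (permStabilizer f x).index ≤ Nat.card X := by
  let _ := MulAction.compHom X f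
  have h : permStabilizer f x = MulAction.stabilizer T x := rfl
  have hidx : (permStabilizer f x).index = (MulAction.orbit T x).ncard := by
    rw [h, MulAction.index_stabilizer]
  refine ⟨⟨?_⟩, ?_⟩
  · rw [hidx]
    exact (Set.ncard_pos (Set.toFinite _)).mpr (MulAction.nonempty_orbit x) |>.ne'
  · rw [hidx, ← Set.ncard_univ]
    exact Set.ncard_le_ncard (Set.subset_univ _) Set.finite_univ

variable {T X Γ : Type*} [Group T] {f : T →* Equiv.Perm X} {x : X} {r : Γ → X → X}

/-- Suppose that `Γ` acts on `X` from the right, commuting with `T`, and that every point with the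
same stabilizer as `x` lies in `x Γ`. Then the normalizer of the stabilizer `H` of `x` consists of
the elements mapping `x` into `x Γ`. -/
theorem mem_normalizer_permStabilizer (hcomm : ∀ g γ y, f g (r γ y) = r γ (f g y))
    (hinj : ∀ γ, Function.Injective (r γ))
    (hrigid : ∀ y, permStabilizer f y = permStabilizer f x → ∃ γ, y = r γ x) {g : T} :
    g ∈ Subgroup.normalizer (permStabilizer f x : Set T) ↔ ∃ γ, f g x = r γ x := by
  have h1 : g ∈ Subgroup.normalizer (permStabilizer f x : Set T) ↔
      permStabilizer f (f g x) = permStabilizer f x := by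
    rw [← permStabilizer_conj, Subgroup.mem_normalizer_iff]
    constructor
    · intro h
      ext k
      rw [Subgroup.mem_map_equiv, MulAut.conj_symm_apply]
      have := h (g⁻¹ * k * g)
      simpa [mul_assoc] using this
    · intro h k
      have : g * k * g⁻¹ ∈ (permStabilizer f x).map (MulAut.conj g).toMonoidHom ↔
          k ∈ permStabilizer f x := by
        rw [Subgroup.mem_map_equiv, MulAut.conj_symm_apply]
        simp [mul_assoc]
      rw [h] at this
      exact this.symm
  rw [h1]
  refine ⟨hrigid _, ?_⟩
  rintro ⟨γ, hγ⟩
  rw [hγ]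
  ext k
  rw [mem_permStabilizer, mem_permStabilizer, hcomm, (hinj γ).eq_iff]

/-- Sending `g` to the `γ` with `g x = x γ` is a homomorphism because the right action commutes with
`T`; its kernel is the stabilizer. -/
theorem nonempty_normalizer_quotient_mulEquiv [Group Γ] (hcomm : ∀ g γ y, f g (r γ y) = r γ (f g y))
    (hinj : ∀ γ, Function.Injective (r γ)) (hfree : ∀ γ γ', r γ x = r γ' x → γ = γ')
    (hone : r 1 x = x) (hmul : ∀ γ γ', r γ' (r γ x) = r (γ * γ') x)
    (hrigid : ∀ y, permStabilizer f y = permStabilizer f x → ∃ γ, y = r γ x)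
    (hsurj : ∀ γ, ∃ g, f g x = r γ x) :
    Nonempty ((Subgroup.normalizer (permStabilizer f x : Set T) ⧸
      (permStabilizer f x).subgroupOf (Subgroup.normalizer (permStabilizer f x : Set T))) ≃* Γ) := by
  have hmem := fun g => mem_normalizer_permStabilizer (g := g) hcomm hinj hrigid
  choose ψ hψ using fun g : Subgroup.normalizer (permStabilizer f x : Set T) => (hmem g).mp g.2
  let Ψ : Subgroup.normalizer (permStabilizer f x : Set T) →* Γ := MonoidHom.mk' ψ (by
    intro a b
    apply hfree
    rw [← hψ, ← hmul, ← hψ, ← hcomm, ← hψ]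
    simp)
  have hΨ : Function.Surjective Ψ := by
    intro γ
    obtain ⟨g, hg⟩ := hsurj γ
    refine ⟨⟨g, (hmem g).mpr ⟨γ, hg⟩⟩, hfree _ _ ?_⟩
    exact (hψ _).symm.trans hg
  have hker : (permStabilizer f x).subgroupOf
      (Subgroup.normalizer (permStabilizer f x : Set T)) = Ψ.ker := by
    ext g
    rw [Subgroup.mem_subgroupOf, mem_permStabilizer, MonoidHom.mem_ker, hψ]
    change r (Ψ g) x = x ↔ _
    constructor
    · intro h
      exact hfree _ _ (h.trans hone.symm)
    · intro h
      rw [h, hone]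
  exact ⟨(QuotientGroup.quotientMulEquivOfEq hker).trans
    (QuotientGroup.quotientKerEquivOfSurjective Ψ hΨ)⟩

end Symmetry

/-! ### The action twisted by voltages -/

section TwistedRep

variable {Q Y : Type*} [Group Q]

/-- Left translation on the first coordinate. -/
def fstTranslation (Q Y : Type*) [Group Q] : Q →* Equiv.Perm (Q × Q × Y) :=
  MonoidHom.mk' (fun a => (Equiv.mulLeft a).prodCongr (Equiv.refl _)) (by
    intro a b; ext p <;> simp [mul_assoc])

/-- Left translation on the second coordinate. -/
def sndTranslation (Q Y : Type*) [Group Q] : Q →* Equiv.Perm (Q × Q × Y) :=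
  MonoidHom.mk' (fun a => (Equiv.refl _).prodCongr ((Equiv.mulLeft a).prodCongr (Equiv.refl _)))
    (by intro a b; ext p <;> simp [mul_assoc])

@[simp]
theorem fstTranslation_apply (a q r : Q) (y : Y) :
    fstTranslation Q Y a (q, r, y) = (a * q, r, y) := rfl

@[simp]
theorem sndTranslation_apply (a q r : Q) (y : Y) :
    sndTranslation Q Y a (q, r, y) = (q, a * r, y) := rfl

@[simp]
theorem fstTranslation_symm_apply (a q r : Q) (y : Y) :
    (fstTranslation Q Y a).symm (q, r, y) = (a⁻¹ * q, r, y) := rfl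

@[simp]
theorem sndTranslation_symm_apply (a q r : Q) (y : Y) :
    (sndTranslation Q Y a).symm (q, r, y) = (q, a⁻¹ * r, y) := rfl

open Classical in
/-- The voltage at the point `(q, r)`: trivial if `q = 1`, and `π r` otherwise. -/
noncomputable def voltage (π : Q → Equiv.Perm Y) (q r : Q) : Equiv.Perm Y :=
  if q = 1 then 1 else π r

@[simp]
theorem voltage_one (π : Q → Equiv.Perm Y) (r : Q) : voltage π 1 r = 1 := if_pos rfl

theorem voltage_of_ne (π : Q → Equiv.Perm Y) {q : Q} (hq : q ≠ 1) (r : Q) :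
    voltage π q r = π r := if_neg hq

/-- The permutation of `Q × Q × Y` acting on fibres by the voltages. -/
noncomputable def voltagePerm (π : Q → Equiv.Perm Y) : Equiv.Perm (Q × Q × Y) where
  toFun p := (p.1, p.2.1, voltage π p.1 p.2.1 p.2.2)
  invFun p := (p.1, p.2.1, (voltage π p.1 p.2.1)⁻¹ p.2.2)
  left_inv p := by simp
  right_inv p := by simp

@[simp]
theorem voltagePerm_apply (π : Q → Equiv.Perm Y) (q r : Q) (y : Y) :
    voltagePerm π (q, r, y) = (q, r, voltage π q r y) := rfl

@[simp]
theorem voltagePerm_symm_apply (π : Q → Equiv.Perm Y) (q r : Q) (y : Y) :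
    (voltagePerm π).symm (q, r, y) = (q, r, (voltage π q r).symm y) := rfl

variable {ι : Type*} {G : ι → Type*} [∀ i, Group (G i)]

open Classical in
/-- The factor `G i₀` translates the first coordinate, twisted by the voltages, and the other
factors translate the second coordinate. -/
noncomputable def twistedRep (i₀ : ι) (φ : ∀ i, G i →* Q) (π : Q → Equiv.Perm Y) :
    Monoid.CoprodI G →* Equiv.Perm (Q × Q × Y) :=
  Monoid.CoprodI.lift fun i =>
    if i = i₀ then
      (MulAut.conj (voltagePerm π)).toMonoidHom.comp ((fstTranslation Q Y).comp (φ i))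
    else (sndTranslation Q Y).comp (φ i)

variable {i₀ : ι} {φ : ∀ i, G i →* Q} {π : Q → Equiv.Perm Y}

theorem twistedRep_of_self (x : G i₀) :
    twistedRep i₀ φ π (Monoid.CoprodI.of x) =
      voltagePerm π * fstTranslation Q Y (φ i₀ x) * (voltagePerm π)⁻¹ := by
  simp [twistedRep]

theorem twistedRep_of_ne {i : ι} (hi : i ≠ i₀) (x : G i) :
    twistedRep i₀ φ π (Monoid.CoprodI.of x) = sndTranslation Q Y (φ i x) := by
  simp [twistedRep, hi]

/-- Voltages do not touch the two `Q`-coordinates, on which a factor acts by pure translation. This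
is the source of freeness. -/
theorem twistedRep_of_apply_eq_self {i : ι} {x : G i} {p : Q × Q × Y}
    (h : twistedRep i₀ φ π (Monoid.CoprodI.of x) p = p) : φ i x = 1 := by
  by_cases hi : i = i₀
  · subst hi
    obtain ⟨q, r, y⟩ := p
    rw [twistedRep_of_self] at h
    simpa using congrArg Prod.fst h
  · obtain ⟨q, r, y⟩ := p
    rw [twistedRep_of_ne hi] at h
    simpa using congrArg (fun z => z.2.1) h

theorem twistedRep_comm {r : Y → Y} (hr : ∀ q y, π q (r y) = r (π q y))
    (g : Monoid.CoprodI G) (p : Q × Q × Y) :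
    twistedRep i₀ φ π g (p.1, p.2.1, r p.2.2) =
      ((twistedRep i₀ φ π g p).1, (twistedRep i₀ φ π g p).2.1,
        r (twistedRep i₀ φ π g p).2.2) := by
  have hv : ∀ q s y, voltage π q s (r y) = r (voltage π q s y) := by
    intro q s y
    by_cases hq : q = 1
    · simp [hq]
    · simp [voltage_of_ne π hq, hr]
  have hvi : ∀ q s y, (voltage π q s).symm (r y) = r ((voltage π q s).symm y) := by
    intro q s y
    rw [Equiv.symm_apply_eq, hv, Equiv.apply_symm_apply]
  induction g using Monoid.CoprodI.induction_on generalizing p with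
  | one => simp
  | of i x =>
    obtain ⟨q, s, y⟩ := p
    by_cases hi : i = i₀
    · subst hi
      rw [twistedRep_of_self]
      simp [hv, hvi]
    · rw [twistedRep_of_ne hi]
      simp
  | mul a b ha hb =>
    rw [map_mul, Equiv.Perm.mul_apply, hb, Equiv.Perm.mul_apply]
    exact ha (twistedRep i₀ φ π b p)

/-- The commutator used to read off the voltages. -/
def voltageWord {j : ι} (x : G i₀) (g : G j) : Monoid.CoprodI G :=
  (Monoid.CoprodI.of g)⁻¹ * (Monoid.CoprodI.of x)⁻¹ * Monoid.CoprodI.of g * Monoid.CoprodI.of x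

/-- The commutator follows the square `(q, r)`, `(x q, r)`, `(x q, g r)`, `(q, g r)` and back; the
fibre picks up the voltages at its corners. -/
theorem twistedRep_voltageWord {j : ι} (hj : j ≠ i₀) (x : G i₀) (g : G j) (q r : Q) (y : Y) :
    twistedRep i₀ φ π (voltageWord x g) (q, r, y) =
      (q, r, voltage π q (φ j g * r) ((voltage π (φ i₀ x * q) (φ j g * r))⁻¹
        (voltage π (φ i₀ x * q) r ((voltage π q r)⁻¹ y)))) := by
  rw [voltageWord, map_mul, map_mul, map_mul, map_inv, map_inv, twistedRep_of_self,
    twistedRep_of_ne hj]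
  simp

/-- Voltages depend on `q` only through whether `q = 1`, so they cancel round the square unless one
of its two columns is `1`. That leaves this case and `φ x * q = 1`. -/
theorem twistedRep_voltageWord_one {j : ι} (hj : j ≠ i₀) {x : G i₀} (hx : φ i₀ x ≠ 1) (g : G j)
    (r : Q) (y : Y) : twistedRep i₀ φ π (voltageWord x g) (1, r, y) =
      (1, r, (π (φ j g * r))⁻¹ (π r y)) := by
  rw [twistedRep_voltageWord hj]
  simp [voltage_of_ne π hx]

theorem twistedRep_voltageWord_of_mul_eq_one {j : ι} (hj : j ≠ i₀) {x : G i₀} {q : Q}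
    (hq : q ≠ 1) (hx : φ i₀ x * q = 1) (g : G j) (r : Q) (y : Y) :
    twistedRep i₀ φ π (voltageWord x g) (q, r, y) = (q, r, π (φ j g * r) ((π r)⁻¹ y)) := by
  rw [twistedRep_voltageWord hj]
  simp [voltage_of_ne π hq, hx]

theorem twistedRep_voltageWord_of_ne {j : ι} (hj : j ≠ i₀) {x : G i₀} {q : Q}
    (hq : q ≠ 1) (hx : φ i₀ x * q ≠ 1) (g : G j) (r : Q) (y : Y) :
    twistedRep i₀ φ π (voltageWord x g) (q, r, y) = (q, r, y) := by
  rw [twistedRep_voltageWord hj]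
  simp [voltage_of_ne π hq, voltage_of_ne π hx]

/-- The property of a subgroup, expressed by two words, that singles out the base fibre. -/
def IsMarked {T : Type*} [Group T] (u v : T) (H : Subgroup T) : Prop :=
  v ∈ H ∧ (u * u)⁻¹ * (v * u) ∈ H ∧ u ∉ H

theorem isMarked_permStabilizer {T X : Type*} [Group T] (f : T →* Equiv.Perm X) (u v : T) (p : X) :
    IsMarked u v (permStabilizer f p) ↔
      f v p = p ∧ f v (f u p) = f u (f u p) ∧ f u p ≠ p := by
  simp [IsMarked, Equiv.symm_apply_eq]

/-- A marked point lies over `(1, 1)` or over `((φ x)⁻¹, 1)`, and the voltages satisfy one of two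
relations there. -/
theorem marked_cases {j k : ι} (hj : j ≠ i₀) (hk : k ≠ i₀) {x : G i₀} (hx : φ i₀ x ≠ 1)
    {g : G j} {h : G k} (hg1 : φ j g ≠ 1) (hh1 : φ k h ≠ 1) (hgh : φ j g ≠ φ k h)
    (hπ1 : π 1 = 1)
    (hπ : ∀ a b w, π a w = π b w → a = b ∨ a = φ k h ∨ b = φ k h) {q r : Q} {y : Y}
    (hm : IsMarked (voltageWord x g) (voltageWord x h)
      (permStabilizer (twistedRep i₀ φ π) (q, r, y))) :
    r = 1 ∧
      (q = 1 ∧ π (φ k h) y = y ∧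
          π (φ k h) ((π (φ j g))⁻¹ ((π (φ j g))⁻¹ y)) = (π (φ j g))⁻¹ y ∨
        π (φ k h) y = y ∧ π (φ k h) (π (φ j g) y) = π (φ j g) (π (φ j g) y)) := by
  rw [isMarked_permStabilizer] at hm
  -- Voltages at distinct elements agree nowhere unless one of them is at `φ h`. The first relation
  -- leaves `r = 1` or `r = φ h`, and the second excludes the latter.
  have base : ∀ w w', π (φ k h * r) w = π r w → π (φ k h * r) w' = π (φ j g * r) w' → r = 1 := by
    intro w w' h1 h2
    rcases hπ _ _ _ h1 with h3 | h3 | h3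
    · exact absurd (by simpa using h3) hh1
    · simpa using h3
    · rcases hπ _ _ _ h2 with h4 | h4 | h4
      · exact absurd (mul_right_cancel h4).symm hgh
      · simpa using h4
      · rw [← h3] at h4
        exact absurd (by simpa using h4) hg1
  by_cases hq : q = 1
  · subst hq
    simp only [twistedRep_voltageWord_one hj hx, twistedRep_voltageWord_one hk hx, Prod.mk.injEq,
      true_and] at hm
    obtain ⟨h1, h2, -⟩ := hm
    have hr : r = 1 := by
      refine base y ((π (φ k h * r))⁻¹ (π r ((π (φ j g * r))⁻¹ (π r y)))) ?_ ?_
      · rw [Equiv.Perm.inv_eq_iff_eq] at h1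
        exact h1.symm
      · conv_rhs => rw [h2]
        simp
    subst hr
    refine ⟨rfl, Or.inl ⟨rfl, ?_⟩⟩
    simp only [mul_one, hπ1, Equiv.Perm.one_apply] at h1 h2
    rw [Equiv.Perm.inv_eq_iff_eq] at h1 h2
    exact ⟨h1.symm, h2.symm⟩
  · by_cases hxq : φ i₀ x * q = 1
    · simp only [twistedRep_voltageWord_of_mul_eq_one hj hq hxq,
        twistedRep_voltageWord_of_mul_eq_one hk hq hxq, Prod.mk.injEq, true_and] at hm
      obtain ⟨h1, h2, -⟩ := hm
      have hr : r = 1 := by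
        refine base ((π r)⁻¹ y) ((π r)⁻¹ (π (φ j g * r) ((π r)⁻¹ y))) ?_ h2
        rw [h1]
        simp
      subst hr
      refine ⟨rfl, Or.inr ?_⟩
      simpa [hπ1] using And.intro h1 h2
    · simp only [twistedRep_voltageWord_of_ne hj hq hxq] at hm
      exact absurd rfl hm.2.2

end TwistedRep

/-! ### Subgroups attached to permutations of `ZMod N` -/

section VoltageData

/-- Translation of the first coordinate of `ZMod N × Γ`. -/
def shiftPerm {N : ℕ} (Γ : Type*) (k : ZMod N) : Equiv.Perm (ZMod N × Γ) :=
  (Equiv.addRight k).prodCongr (Equiv.refl Γ)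

@[simp]
theorem shiftPerm_apply {N : ℕ} {Γ : Type*} (k t : ZMod N) (δ : Γ) :
    shiftPerm Γ k (t, δ) = (t + k, δ) := rfl

@[simp]
theorem shiftPerm_symm_apply {N : ℕ} {Γ : Type*} (k t : ZMod N) (δ : Γ) :
    (shiftPerm Γ k).symm (t, δ) = (t - k, δ) := by
  rw [Equiv.symm_apply_eq]; simp

/-- The lift of a permutation `σ` to `Z × Γ` with voltages `c`. -/
def twistPerm {Z Γ : Type*} [Group Γ] (σ : Equiv.Perm Z) (c : Z → Γ) : Equiv.Perm (Z × Γ) where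
  toFun p := (σ p.1, c p.1 * p.2)
  invFun p := (σ.symm p.1, (c (σ.symm p.1))⁻¹ * p.2)
  left_inv p := by simp
  right_inv p := by simp

@[simp]
theorem twistPerm_apply {Z Γ : Type*} [Group Γ] (σ : Equiv.Perm Z) (c : Z → Γ) (t : Z) (δ : Γ) :
    twistPerm σ c (t, δ) = (σ t, c t * δ) := rfl

/-- Conditions on a permutation ensuring that the point `0` is singled out by the displacements
of the permutation. -/
structure IsRigidPerm {N : ℕ} (σ : Equiv.Perm (ZMod N)) : Prop where
  map_zero : σ 0 = 0
  map_neg_two : σ (-2) = -1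
  map_neg_three : σ (-3) ≠ -3
  eq_neg_two : ∀ t, σ t = t + 1 → t = -2

/-- The data needed to construct permutation representations of a free product on
`Q × Q × (ZMod N × Γ)` from permutations of `ZMod N`. -/
structure VoltageData {ι : Type*} (G : ι → Type*) [∀ i, Group (G i)] (Q : Type*) [Group Q]
    (Γ : Type*) [Group Γ] (N : ℕ) where
  i₀ : ι
  j : ι
  k : ι
  hj : j ≠ i₀
  hk : k ≠ i₀
  φ : ∀ i, G i →* Q
  x : G i₀
  g : G j
  h : G k
  hx : φ i₀ x ≠ 1
  hg : φ j g ≠ 1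
  hh : φ k h ≠ 1
  hgh : φ j g ≠ φ k h
  c : ZMod N → Γ
  c_zero : c 0 = 1
  c_neg_two : c (-2) = 1
  c_surjective : Function.Surjective c
  l : Q → ZMod N
  l_injective : Function.Injective l
  l_one : l 1 = 0
  l_g : l (φ j g) = 1

namespace VoltageData

variable {ι : Type*} {G : ι → Type*} [∀ i, Group (G i)] {Q : Type*} [Group Q]
  {Γ : Type*} [Group Γ] {N : ℕ} (D : VoltageData G Q Γ N) (σ τ : Equiv.Perm (ZMod N))

open Classical in
/-- The voltages: shifts by distinct amounts, except for the permutation `σ` at one element. -/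
noncomputable def volt (r : Q) : Equiv.Perm (ZMod N × Γ) :=
  if r = D.φ D.k D.h then twistPerm σ D.c else shiftPerm Γ (D.l r)

theorem volt_h : D.volt σ (D.φ D.k D.h) = twistPerm σ D.c := if_pos rfl

theorem volt_of_ne {r : Q} (hr : r ≠ D.φ D.k D.h) : D.volt σ r = shiftPerm Γ (D.l r) := if_neg hr

theorem volt_one : D.volt σ 1 = 1 := by
  rw [volt_of_ne _ _ D.hh.symm, D.l_one]
  ext p <;> simp [shiftPerm]

theorem volt_g : D.volt σ (D.φ D.j D.g) = shiftPerm Γ 1 := by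
  rw [volt_of_ne _ _ D.hgh, D.l_g]

theorem volt_eq_cases (a b : Q) (w : ZMod N × Γ) (h : D.volt σ a w = D.volt σ b w) :
    a = b ∨ a = D.φ D.k D.h ∨ b = D.φ D.k D.h := by
  by_contra! hne
  obtain ⟨h1, h2, h3⟩ := hne
  rw [D.volt_of_ne σ h2, D.volt_of_ne σ h3] at h
  exact h1 (D.l_injective (by simpa [shiftPerm] using congrArg Prod.fst h))

/-- The representation attached to a permutation. -/
noncomputable def rep : Monoid.CoprodI G →* Equiv.Perm (Q × Q × (ZMod N × Γ)) :=
  twistedRep D.i₀ D.φ (D.volt σ)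

/-- The word reading off the shift. -/
def shiftWord : Monoid.CoprodI G := voltageWord D.x D.g

/-- The word reading off the permutation. -/
def permWord : Monoid.CoprodI G := voltageWord D.x D.h

/-- Right translation of the last coordinate. -/
def rightTranslation (Q : Type*) (N : ℕ) (γ : Γ) (p : Q × Q × (ZMod N × Γ)) :
    Q × Q × (ZMod N × Γ) := (p.1, p.2.1, (p.2.2.1, p.2.2.2 * γ))

/-- The stabilizer of the base point. -/
noncomputable def subgroup : Subgroup (Monoid.CoprodI G) :=
  permStabilizer (D.rep σ) (1, 1, (0, 1))

theorem rep_shiftWord (t : ZMod N) (δ : Γ) :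
    D.rep σ D.shiftWord (1, 1, (t, δ)) = (1, 1, (t - 1, δ)) := by
  rw [rep, shiftWord, twistedRep_voltageWord_one D.hj D.hx]
  simp [volt_one, volt_g]

theorem rep_permWord (t : ZMod N) (δ : Γ) :
    D.rep σ D.permWord (1, 1, (t, δ)) = (1, 1, (twistPerm σ D.c).symm (t, δ)) := by
  rw [rep, permWord, twistedRep_voltageWord_one D.hk D.hx]
  simp [volt_one, volt_h]

theorem rep_comm (g : Monoid.CoprodI G) (γ : Γ) (p : Q × Q × (ZMod N × Γ)) :
    D.rep σ g (rightTranslation Q N γ p) = rightTranslation Q N γ (D.rep σ g p) := by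
  refine twistedRep_comm (r := fun y : ZMod N × Γ => (y.1, y.2 * γ)) ?_ g p
  intro q y
  by_cases hq : q = D.φ D.k D.h
  · rw [hq, volt_h]
    simp [twistPerm, mul_assoc]
  · rw [D.volt_of_ne σ hq]
    simp [shiftPerm]

variable {σ τ}

/-- Over `(1, 1)` the marking reads `σ (t - 2) = t - 1`, forcing `t = 0`. Over the other corner it
reads `σ t = t` and `σ (t + 1) = t + 2`, forcing `t = -3`, which `σ` moves. -/
theorem exists_of_isMarked (hσ : IsRigidPerm σ) {p : Q × Q × (ZMod N × Γ)}
    (hp : IsMarked D.shiftWord D.permWord (permStabilizer (D.rep σ) p)) :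
    ∃ γ, p = rightTranslation Q N γ (1, 1, (0, 1)) := by
  obtain ⟨q, r, t, δ⟩ := p
  obtain ⟨rfl, h | h⟩ := marked_cases D.hj D.hk D.hx D.hg D.hh D.hgh (D.volt_one σ)
    (D.volt_eq_cases σ) hp
  · obtain ⟨rfl, -, h2⟩ := h
    rw [volt_h, volt_g] at h2
    have h3 : σ (t - 1 - 1) = t - 1 := by simpa using congrArg Prod.fst h2
    have h4 := hσ.eq_neg_two (t - 1 - 1) (by rw [h3]; ring)
    have h5 : t = 0 := by linear_combination h4
    exact ⟨δ, by simp [rightTranslation, h5]⟩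
  · obtain ⟨h1, h2⟩ := h
    rw [volt_h] at h1 h2
    rw [volt_g] at h2
    have h3 : σ t = t := by simpa using congrArg Prod.fst h1
    have h4 : σ (t + 1) = t + 1 + 1 := by simpa using congrArg Prod.fst h2
    have h5 := hσ.eq_neg_two _ h4
    have h6 : t = -3 := by linear_combination h5
    exact absurd (h6 ▸ h3) hσ.map_neg_three

theorem isMarked_subgroup (hσ : IsRigidPerm σ) :
    IsMarked D.shiftWord D.permWord (D.subgroup σ) := by
  rw [subgroup, isMarked_permStabilizer, rep_permWord, rep_shiftWord, rep_permWord, rep_shiftWord]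
  refine ⟨?_, ?_, ?_⟩
  · congr 2
    rw [Equiv.symm_apply_eq]
    simp [hσ.map_zero, D.c_zero]
  · congr 2
    rw [Equiv.symm_apply_eq]
    have : (-1 - 1 : ZMod N) = -2 := by ring
    simp [this, hσ.map_neg_two, D.c_neg_two]
  -- The shift is nontrivial because the injective `l` takes the distinct values `1` and `0`.
  · intro h
    have h1 : (1 : ZMod N) = 0 := by simpa using h
    rw [← D.l_g, ← D.l_one] at h1
    exact D.hg (D.l_injective h1)

theorem rightTranslation_injective {Q : Type*} (γ : Γ) : Function.Injective (rightTranslation Q N γ) := by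
  rintro ⟨q, r, t, δ⟩ ⟨q', r', t', δ'⟩ h
  simpa [rightTranslation] using h

theorem permStabilizer_rightTranslation (γ : Γ) (p : Q × Q × (ZMod N × Γ)) :
    permStabilizer (D.rep σ) (rightTranslation Q N γ p) = permStabilizer (D.rep σ) p := by
  ext g
  rw [mem_permStabilizer, mem_permStabilizer, rep_comm, (rightTranslation_injective γ).eq_iff]

theorem eq_subgroup_of_isMarked (hσ : IsRigidPerm σ) {p : Q × Q × (ZMod N × Γ)}
    (hp : IsMarked D.shiftWord D.permWord (permStabilizer (D.rep σ) p)) :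
    permStabilizer (D.rep σ) p = D.subgroup σ := by
  obtain ⟨γ, rfl⟩ := D.exists_of_isMarked hσ hp
  exact D.permStabilizer_rightTranslation γ _

theorem exists_of_permStabilizer_eq (hσ : IsRigidPerm σ) (p : Q × Q × (ZMod N × Γ))
    (hp : permStabilizer (D.rep σ) p = permStabilizer (D.rep σ) (1, 1, (0, 1))) :
    ∃ γ, p = rightTranslation Q N γ (1, 1, (0, 1)) :=
  D.exists_of_isMarked hσ (hp ▸ D.isMarked_subgroup hσ)

theorem mem_normalizer_subgroup (hσ : IsRigidPerm σ) (g : Monoid.CoprodI G) :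
    g ∈ Subgroup.normalizer (D.subgroup σ : Set (Monoid.CoprodI G)) ↔
      ∃ γ, D.rep σ g (1, 1, (0, 1)) = rightTranslation Q N γ (1, 1, (0, 1)) :=
  mem_normalizer_permStabilizer (D.rep_comm σ) rightTranslation_injective
    (D.exists_of_permStabilizer_eq hσ)

/-- The word testing whether the permutation maps `t` to `t'`. -/
def testWord (t t' : ZMod N) : Monoid.CoprodI G :=
  D.shiftWord ^ t'.val * D.permWord⁻¹ * (D.shiftWord ^ t.val)⁻¹

theorem rep_shiftWord_pow (n : ℕ) (t : ZMod N) (δ : Γ) :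
    D.rep σ (D.shiftWord ^ n) (1, 1, (t, δ)) = (1, 1, (t - n, δ)) := by
  induction n generalizing t with
  | zero => simp
  | succ n ih =>
    rw [pow_succ, map_mul, Equiv.Perm.mul_apply, rep_shiftWord, ih]
    congr 3
    push_cast
    ring

/-- Powers of the shift carry the base point to `t`; the inverse of `permWord` then applies `σ` and
the label `c t`, and further shifts subtract `t'`. -/
theorem rep_testWord [NeZero N] (t t' : ZMod N) :
    D.rep σ (D.testWord t t') (1, 1, (0, 1)) = (1, 1, (σ t - t', D.c t)) := by
  have h1 : (D.rep σ (D.shiftWord ^ t.val))⁻¹ (1, 1, (0, 1)) = (1, 1, (t, 1)) := by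
    rw [Equiv.Perm.inv_eq_iff_eq, rep_shiftWord_pow]
    simp
  have h2 : (D.rep σ D.permWord)⁻¹ (1, 1, (t, 1)) = (1, 1, (σ t, D.c t)) := by
    rw [Equiv.Perm.inv_eq_iff_eq, rep_permWord]
    congr 2
    rw [Equiv.eq_symm_apply]
    simp
  rw [testWord, map_mul, map_mul, map_inv, map_inv, Equiv.Perm.mul_apply, Equiv.Perm.mul_apply,
    h1, h2, rep_shiftWord_pow]
  simp

theorem testWord_mem_normalizer_iff [NeZero N] (hσ : IsRigidPerm σ) (t t' : ZMod N) :
    D.testWord t t' ∈ Subgroup.normalizer (D.subgroup σ : Set (Monoid.CoprodI G)) ↔ σ t = t' := by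
  rw [D.mem_normalizer_subgroup hσ, rep_testWord]
  simp [rightTranslation, sub_eq_zero]

/-- Subgroups attached to different permutations are not conjugate. -/
theorem eq_of_conjClassOf_eq [NeZero N] (hσ : IsRigidPerm σ) (hτ : IsRigidPerm τ)
    (h : conjClassOf (D.subgroup σ) = conjClassOf (D.subgroup τ)) : σ = τ := by
  have hmem : D.subgroup τ ∈ conjClassOf (D.subgroup σ) := by
    rw [h]
    refine ⟨1, ?_⟩
    rw [subgroup, permStabilizer_conj]
    simp
  obtain ⟨g, hg⟩ := hmem
  rw [show D.subgroup σ = permStabilizer (D.rep σ) (1, 1, (0, 1)) from rfl,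
    permStabilizer_conj] at hg
  -- A conjugate of the first subgroup is the stabilizer of another point of the same action. Being
  -- marked, it equals the first subgroup itself.
  have heq : D.subgroup τ = D.subgroup σ := by
    rw [← D.eq_subgroup_of_isMarked hσ (hg ▸ D.isMarked_subgroup hτ)]
    exact hg
  ext1 t
  have h1 := (D.testWord_mem_normalizer_iff hτ t (τ t)).mpr rfl
  rw [heq] at h1
  exact (D.testWord_mem_normalizer_iff hσ t (τ t)).mp h1

theorem isFreeWithSymmetry_subgroup [NeZero N] [Finite Q] [Finite Γ] [∀ i, IsCyclic (G i)]
    (hφ : ∀ i, Finite (G i) → Function.Injective (D.φ i)) (hσ : IsRigidPerm σ) :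
    IsFreeWithSymmetry Γ (Nat.card Q * Nat.card Q * N * Nat.card Γ) (D.subgroup σ) := by
  have hidx := permStabilizer_index_le (D.rep σ) (1, 1, (0, 1))
  refine ⟨?_, hidx.1, hidx.2.trans ?_, ?_⟩
  · apply Monoid.CoprodI.isFreeGroup_of_isCyclic
    intro i hi y k hk
    rw [subgroup, mem_permStabilizer, map_mul, map_mul, map_inv, Equiv.Perm.mul_apply,
      Equiv.Perm.mul_apply, Equiv.Perm.inv_eq_iff_eq] at hk
    have := twistedRep_of_apply_eq_self hk
    exact hφ i hi (by rw [this, map_one])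
  · simp [Nat.card_prod, mul_assoc]
  · refine nonempty_normalizer_quotient_mulEquiv (r := rightTranslation Q N) (D.rep_comm σ)
      rightTranslation_injective ?_ ?_ ?_ (D.exists_of_permStabilizer_eq hσ) ?_
    · intro γ γ' h
      simpa [rightTranslation] using h
    · simp [rightTranslation]
    · intro γ γ'
      simp [rightTranslation]
    · intro γ
      obtain ⟨t, rfl⟩ := D.c_surjective γ
      -- This word moves the base point to its translate by `c t`, and `c` is onto `Γ`.
      refine ⟨D.testWord t (σ t), ?_⟩
      rw [rep_testWord]
      simp [rightTranslation]

end VoltageData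

end VoltageData

/-! ### A large family of rigid permutations -/

section RigidPermutations

/-- The embedding of `Fin M` onto the even numbers `2, …, 2 M`. -/
def evenEmbedding (M : ℕ) : Fin M ↪ ZMod (2 * M + 6) where
  toFun j := ((2 * j + 2 : ℕ) : ZMod (2 * M + 6))
  inj' := by
    intro a b h
    have h1 := congrArg ZMod.val h
    dsimp only at h1
    rw [ZMod.val_cast_of_lt (by omega), ZMod.val_cast_of_lt (by omega)] at h1
    omega

theorem natCast_ne_zero_of_lt {N n : ℕ} (h0 : 0 < n) (hn : n < N) : (n : ZMod N) ≠ 0 := by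
  rw [Ne, ZMod.natCast_eq_zero_iff]
  exact fun h => absurd (Nat.le_of_dvd h0 h) (by omega)

theorem neg_notMem_range_evenEmbedding {M k : ℕ} (hk : k ≤ 5) :
    -(k : ZMod (2 * M + 6)) ∉ Set.range (evenEmbedding M) := by
  rintro ⟨j, hj⟩
  have h1 : ((2 * j + 2 + k : ℕ) : ZMod (2 * M + 6)) = 0 := by
    have : ((2 * j + 2 : ℕ) : ZMod (2 * M + 6)) = -(k : ZMod (2 * M + 6)) := hj
    rw [Nat.cast_add, this, neg_add_cancel]
  exact natCast_ne_zero_of_lt (by omega) (by omega) h1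

/-- The rigid permutation of `ZMod (2 M + 6)` extending a permutation of the points
`2, …, 2 M`. -/
noncomputable def rigidPerm {M : ℕ} (τ : Equiv.Perm (Fin M)) : Equiv.Perm (ZMod (2 * M + 6)) :=
  Equiv.Perm.viaEmbeddingHom (evenEmbedding M) τ * (Equiv.swap (-2) (-1) * Equiv.swap (-3) (-5))

theorem rigidPerm_injective {M : ℕ} : Function.Injective (rigidPerm (M := M)) := by
  intro τ τ' h
  exact Equiv.Perm.viaEmbeddingHom_injective _ (mul_right_cancel h)

/-- The swaps arrange `-2 ↦ -1` and move `-3`, without creating another displacement `+1`. The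
modulus is even, so permuting even residues gives only even displacements. -/
theorem isRigidPerm_rigidPerm {M : ℕ} (τ : Equiv.Perm (Fin M)) : IsRigidPerm (rigidPerm τ) := by
  have hne : ∀ n : ℕ, 0 < n → n ≤ 5 → (n : ZMod (2 * M + 6)) ≠ 0 := fun n h0 h5 =>
    natCast_ne_zero_of_lt h0 (by omega)
  have n1 : (1 : ZMod (2 * M + 6)) ≠ 0 := by simpa using hne 1 (by norm_num) (by norm_num)
  have n2 : (2 : ZMod (2 * M + 6)) ≠ 0 := by simpa using hne 2 (by norm_num) (by norm_num)
  have n3 : (3 : ZMod (2 * M + 6)) ≠ 0 := by simpa using hne 3 (by norm_num) (by norm_num)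
  have n4 : (4 : ZMod (2 * M + 6)) ≠ 0 := by simpa using hne 4 (by norm_num) (by norm_num)
  have n5 : (5 : ZMod (2 * M + 6)) ≠ 0 := by simpa using hne 5 (by norm_num) (by norm_num)
  have hfix : ∀ t, t ∉ Set.range (evenEmbedding M) →
      Equiv.Perm.viaEmbeddingHom (evenEmbedding M) τ t = t := fun t ht =>
    Equiv.Perm.viaEmbedding_apply_of_notMem _ _ _ ht
  have hneg : ∀ k : ℕ, k ≤ 5 → Equiv.Perm.viaEmbeddingHom (evenEmbedding M) τ
      (-(k : ZMod (2 * M + 6))) = -(k : ZMod (2 * M + 6)) := fun k hk =>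
    hfix _ (neg_notMem_range_evenEmbedding hk)
  have f0 : Equiv.Perm.viaEmbeddingHom (evenEmbedding M) τ 0 = 0 := by
    simpa using hneg 0 (by norm_num)
  have f1 : Equiv.Perm.viaEmbeddingHom (evenEmbedding M) τ (-1) = -1 := by
    simpa using hneg 1 (by norm_num)
  have f2 : Equiv.Perm.viaEmbeddingHom (evenEmbedding M) τ (-2) = -2 := by
    simpa using hneg 2 (by norm_num)
  have f3 : Equiv.Perm.viaEmbeddingHom (evenEmbedding M) τ (-3) = -3 := by
    simpa using hneg 3 (by norm_num)
  have f5 : Equiv.Perm.viaEmbeddingHom (evenEmbedding M) τ (-5) = -5 := by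
    simpa using hneg 5 (by norm_num)
  have d12 : (-1 : ZMod (2 * M + 6)) ≠ -2 := fun h => n1 (by linear_combination h)
  have d13 : (-1 : ZMod (2 * M + 6)) ≠ -3 := fun h => n2 (by linear_combination h)
  have d15 : (-1 : ZMod (2 * M + 6)) ≠ -5 := fun h => n4 (by linear_combination h)
  have d23 : (-2 : ZMod (2 * M + 6)) ≠ -3 := fun h => n1 (by linear_combination h)
  have d25 : (-2 : ZMod (2 * M + 6)) ≠ -5 := fun h => n3 (by linear_combination h)
  have d35 : (-3 : ZMod (2 * M + 6)) ≠ -5 := fun h => n2 (by linear_combination h)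
  have v1 : rigidPerm τ (-1) = -2 := by
    rw [rigidPerm, Equiv.Perm.mul_apply, Equiv.Perm.mul_apply, Equiv.swap_apply_of_ne_of_ne d13 d15,
      Equiv.swap_apply_right, f2]
  have v2 : rigidPerm τ (-2) = -1 := by
    rw [rigidPerm, Equiv.Perm.mul_apply, Equiv.Perm.mul_apply, Equiv.swap_apply_of_ne_of_ne d23 d25,
      Equiv.swap_apply_left, f1]
  have v3 : rigidPerm τ (-3) = -5 := by
    rw [rigidPerm, Equiv.Perm.mul_apply, Equiv.Perm.mul_apply, Equiv.swap_apply_left,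
      Equiv.swap_apply_of_ne_of_ne d25.symm d15.symm, f5]
  have v5 : rigidPerm τ (-5) = -3 := by
    rw [rigidPerm, Equiv.Perm.mul_apply, Equiv.Perm.mul_apply, Equiv.swap_apply_right,
      Equiv.swap_apply_of_ne_of_ne d23.symm d13.symm, f3]
  have vother : ∀ t, t ≠ -1 → t ≠ -2 → t ≠ -3 → t ≠ -5 →
      rigidPerm τ t = Equiv.Perm.viaEmbeddingHom (evenEmbedding M) τ t := by
    intro t h1 h2 h3 h5
    rw [rigidPerm, Equiv.Perm.mul_apply, Equiv.Perm.mul_apply, Equiv.swap_apply_of_ne_of_ne h3 h5,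
      Equiv.swap_apply_of_ne_of_ne h2 h1]
  refine ⟨?_, v2, ?_, fun t ht => ?_⟩
  · rw [vother, f0]
    · exact fun h => n1 (by linear_combination h)
    · exact fun h => n2 (by linear_combination h)
    · exact fun h => n3 (by linear_combination h)
    · exact fun h => n5 (by linear_combination h)
  · rw [v3]
    exact d35.symm
  · by_contra h2
    by_cases h1 : t = -1
    · rw [h1, v1] at ht
      exact n2 (by linear_combination -ht)
    by_cases h3 : t = -3
    · rw [h3, v3] at ht
      exact n3 (by linear_combination -ht)
    by_cases h5 : t = -5
    · rw [h5, v5] at ht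
      exact n1 (by linear_combination ht)
    rw [vother t h1 h2 h3 h5] at ht
    by_cases hr : t ∈ Set.range (evenEmbedding M)
    · obtain ⟨j, rfl⟩ := hr
      rw [Equiv.Perm.viaEmbeddingHom_apply, Equiv.Perm.viaEmbedding_apply] at ht
      have hdvd : 2 ∣ 2 * M + 6 := ⟨M + 3, by ring⟩
      have hev : ∀ i, ZMod.castHom hdvd (ZMod 2) (evenEmbedding M i) = 0 := by
        intro i
        change ZMod.castHom hdvd (ZMod 2) ((2 * i + 2 : ℕ) : ZMod (2 * M + 6)) = 0
        rw [map_natCast, ZMod.natCast_eq_zero_iff]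
        exact ⟨i + 1, by ring⟩
      have := congrArg (ZMod.castHom hdvd (ZMod 2)) ht
      rw [map_add, hev, hev, map_one] at this
      exact absurd this (by decide)
    · rw [hfix t hr] at ht
      exact n1 (by linear_combination -ht)

end RigidPermutations

/-! ### Choosing the quotient, labels and shifts -/

section Existence

/-- The residues `1, …, |Γ|` enumerate `Γ` and all others get `1`; the bound on `N` keeps `-2`
outside that range. -/
theorem exists_surjective_labelling (Γ : Type*) [Group Γ] [Finite Γ] {N : ℕ}
    (hN : Nat.card Γ + 2 < N) :
    ∃ c : ZMod N → Γ, c 0 = 1 ∧ c (-2) = 1 ∧ Function.Surjective c := by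
  classical
  have : NeZero N := ⟨by omega⟩
  let e := (Finite.equivFin Γ).symm
  refine ⟨fun t => if h : 1 ≤ t.val ∧ t.val ≤ Nat.card Γ then e ⟨t.val - 1, by omega⟩ else 1,
    ?_, ?_, ?_⟩
  · simp
  · have h2 : (-2 : ZMod N) = ((N - 2 : ℕ) : ZMod N) := by
      rw [Nat.cast_sub (by omega)]
      simp
    have h3 : (-2 : ZMod N).val = N - 2 := by
      rw [h2, ZMod.val_cast_of_lt (by omega)]
    refine dif_neg ?_
    rw [h3]
    omega
  · intro γ
    obtain ⟨i, rfl⟩ := e.surjective γ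
    refine ⟨((i + 1 : ℕ) : ZMod N), ?_⟩
    have hi := i.2
    have hv : (((i : ℕ) + 1 : ℕ) : ZMod N).val = i + 1 := ZMod.val_cast_of_lt (by omega)
    have hc : 1 ≤ (((i : ℕ) + 1 : ℕ) : ZMod N).val ∧
        (((i : ℕ) + 1 : ℕ) : ZMod N).val ≤ Nat.card Γ := by
      rw [hv]
      omega
    refine (dif_pos hc).trans ?_
    congr 1
    ext
    simp only [hv]
    omega

theorem exists_injective_shift {Q : Type*} [Group Q] [Finite Q] {a : Q} (ha : a ≠ 1) {N : ℕ}
    (hN : Nat.card Q < N) :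
    ∃ l : Q → ZMod N, Function.Injective l ∧ l 1 = 0 ∧ l a = 1 := by
  classical
  have : NeZero N := ⟨by omega⟩
  have hcard : 1 < Nat.card Q := by
    have : Nontrivial Q := ⟨a, 1, ha⟩
    exact Finite.one_lt_card
  have h10 : (1 : ZMod N) ≠ 0 := by
    have : Fact (1 < N) := ⟨by omega⟩
    exact one_ne_zero
  have := Fintype.ofFinite Q
  obtain ⟨e⟩ : Nonempty (Q ↪ ZMod N) := by
    rw [Function.Embedding.nonempty_iff_card_le, ZMod.card, ← Nat.card_eq_fintype_card]
    exact hN.le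
  let e₁ : Q → ZMod N := fun q => Equiv.swap (e 1) 0 (e q)
  have he₁ : Function.Injective e₁ := (Equiv.injective _).comp e.injective
  have he0 : e₁ 1 = 0 := Equiv.swap_apply_left _ _
  have hea : e₁ a ≠ 0 := fun h => ha (he₁ (h.trans he0.symm))
  refine ⟨fun q => Equiv.swap (e₁ a) 1 (e₁ q), (Equiv.injective _).comp he₁, ?_, ?_⟩
  · simp only [he0]
    exact Equiv.swap_apply_of_ne_of_ne hea.symm h10.symm
  · exact Equiv.swap_apply_left _ _

theorem exists_cyclic_quotient (G : Type*) [Group G] [IsCyclic G] [Nontrivial G] :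
    ∃ (m : ℕ) (f : G →* Multiplicative (ZMod m)), 2 ≤ m ∧ (Nat.card G ≠ 2 → 3 ≤ m) ∧
      Function.Surjective f ∧ (Finite G → Function.Injective f) := by
  rcases finite_or_infinite G with hfin | hinf
  · have h2 : 1 < Nat.card G := Finite.one_lt_card
    exact ⟨Nat.card G, (zmodCyclicMulEquiv ‹IsCyclic G›).symm.toMonoidHom, h2,
      fun h => by omega, (zmodCyclicMulEquiv ‹IsCyclic G›).symm.surjective,
      fun _ => (zmodCyclicMulEquiv ‹IsCyclic G›).symm.injective⟩
  · have hcard : Nat.card G = 0 := Nat.card_eq_zero_of_infinite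
    let e : Multiplicative (ZMod (Nat.card G)) ≃* G := zmodCyclicMulEquiv ‹IsCyclic G›
    -- Any finite quotient with at least two nontrivial elements would do; `ℤ/3` is the smallest.
    refine ⟨3, (AddMonoidHom.toMultiplicative
      (ZMod.castHom (show 3 ∣ Nat.card G by rw [hcard]; exact dvd_zero 3)
        (ZMod 3)).toAddMonoidHom).comp e.symm.toMonoidHom, by norm_num, fun _ => le_rfl, ?_,
      fun h => absurd h (not_finite_iff_infinite.mpr hinf)⟩
    have h1 : Function.Surjective (AddMonoidHom.toMultiplicative
        (ZMod.castHom (show 3 ∣ Nat.card G by rw [hcard]; exact dvd_zero 3)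
        (ZMod 3)).toAddMonoidHom) :=
      ZMod.castHom_surjective (show 3 ∣ Nat.card G by rw [hcard]; exact dvd_zero 3)
    exact h1.comp e.symm.surjective

/-- Finite quotients of the factors, and elements of the factors, as needed to construct
`VoltageData`. -/
theorem exists_finite_quotient.{u, v} {ι : Type u} [Finite ι] [Nontrivial ι] (G : ι → Type v)
    [∀ i, Group (G i)] [∀ i, IsCyclic (G i)] [∀ i, Nontrivial (G i)]
    (hT : ¬(Nat.card ι = 2 ∧ ∀ i, Nat.card (G i) = 2)) :
    ∃ (Q : Type u) (_ : Group Q) (_ : Finite Q) (φ : ∀ i, G i →* Q) (i₀ j k : ι) (x : G i₀)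
      (g : G j) (h : G k), (∀ i, Finite (G i) → Function.Injective (φ i)) ∧ j ≠ i₀ ∧ k ≠ i₀ ∧
        φ i₀ x ≠ 1 ∧ φ j g ≠ 1 ∧ φ k h ≠ 1 ∧ φ j g ≠ φ k h := by
  classical
  choose m f hm2 hm3 hsurj hinj using fun i => exists_cyclic_quotient (G i)
  have hne : ∀ i, NeZero (m i) := fun i => ⟨by have := hm2 i; omega⟩
  let φ : ∀ i, G i →* (∀ i, Multiplicative (ZMod (m i))) := fun i =>
    (MonoidHom.mulSingle (fun i => Multiplicative (ZMod (m i))) i).comp (f i)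
  have hφ : ∀ i y, φ i y = Pi.mulSingle i (f i y) := fun i y => rfl
  have hnt : ∀ i, ∃ y, f i y ≠ 1 := by
    intro i
    have : Fact (1 < m i) := ⟨hm2 i⟩
    obtain ⟨z, hz⟩ := exists_ne (1 : Multiplicative (ZMod (m i)))
    obtain ⟨y, rfl⟩ := hsurj i z
    exact ⟨y, hz⟩
  have hφ1 : ∀ i y, f i y ≠ 1 → φ i y ≠ 1 := by
    intro i y h
    rw [hφ, Ne, Pi.mulSingle_eq_one_iff]
    exact h
  have hφinj : ∀ i, Finite (G i) → Function.Injective (φ i) := fun i hi =>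
    (Pi.mulSingle_injective i).comp (hinj i hi)
  refine ⟨∀ i, Multiplicative (ZMod (m i)), inferInstance, inferInstance, φ, ?_⟩
  -- If all factors have order `2`, there are at least three, and `g`, `h` come from different ones.
  -- Otherwise both come from one factor whose quotient has at least three elements.
  by_cases hall : ∀ i, Nat.card (G i) = 2
  · have hι : 2 < Nat.card ι := by
      have h1 : 1 < Nat.card ι := Finite.one_lt_card
      have h2 : Nat.card ι ≠ 2 := fun h => hT ⟨h, hall⟩
      omega
    have := Fintype.ofFinite ι
    rw [Nat.card_eq_fintype_card, Fintype.two_lt_card_iff] at hι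
    obtain ⟨i₀, j, k, h0j, h0k, hjk⟩ := hι
    obtain ⟨x, hx⟩ := hnt i₀
    obtain ⟨g, hg⟩ := hnt j
    obtain ⟨h, hh⟩ := hnt k
    refine ⟨i₀, j, k, x, g, h, hφinj, h0j.symm, h0k.symm, hφ1 _ _ hx, hφ1 _ _ hg, hφ1 _ _ hh, ?_⟩
    intro heq
    rw [hφ, hφ] at heq
    have := congrFun heq j
    rw [Pi.mulSingle_eq_same, Pi.mulSingle_eq_of_ne hjk] at this
    exact hg this
  · push Not at hall
    obtain ⟨j, hj⟩ := hall
    obtain ⟨i₀, hi₀⟩ := exists_ne j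
    obtain ⟨x, hx⟩ := hnt i₀
    have h3 : 2 < Fintype.card (Multiplicative (ZMod (m j))) := by
      rw [Fintype.card_multiplicative, ZMod.card]
      exact hm3 j hj
    obtain ⟨a, b, ha, hb, hab⟩ : ∃ a b : Multiplicative (ZMod (m j)), a ≠ 1 ∧ b ≠ 1 ∧ a ≠ b := by
      obtain ⟨a, ha⟩ := hnt j
      obtain ⟨b, -, hb⟩ := Finset.exists_mem_notMem_of_card_lt_card
        (Finset.card_le_two (a := 1) (b := f j a) |>.trans_lt h3)
      simp only [Finset.mem_insert, Finset.mem_singleton, not_or] at hb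
      exact ⟨f j a, b, ha, hb.1, fun h => hb.2 h.symm⟩
    obtain ⟨g, rfl⟩ := hsurj j a
    obtain ⟨h, rfl⟩ := hsurj j b
    refine ⟨i₀, j, j, x, g, h, hφinj, hi₀.symm, hi₀.symm, hφ1 _ _ hx, hφ1 _ _ ha, hφ1 _ _ hb, ?_⟩
    exact fun heq => hab (Pi.mulSingle_injective j heq)

/-- There is a constant `C` such that for all large `M` there are at least `M!` conjugacy classes
of free subgroups of index at most `C (2 M + 6)` with the given symmetry group. -/
theorem exists_factorial_le_ncard {ι : Type*} [Finite ι] [Nontrivial ι] (G : ι → Type*)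
    [∀ i, Group (G i)] [∀ i, IsCyclic (G i)] [∀ i, Nontrivial (G i)]
    (hT : ¬(Nat.card ι = 2 ∧ ∀ i, Nat.card (G i) = 2)) (Γ : Type*) [Group Γ] [Finite Γ] :
    ∃ C M₀ : ℕ, 0 < C ∧ ∀ M d : ℕ, M₀ ≤ M → C * (2 * M + 6) ≤ d →
      M.factorial ≤ (freeSymmetryClasses (Monoid.CoprodI G) Γ d).ncard := by
  obtain ⟨Q, _, _, φ, i₀, j, k, x, g, h, hφ, hj, hk, hx, hg, hh, hgh⟩ :=
    exists_finite_quotient G hT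
  -- The action has `|Q|² · N · |Γ|` points with `N = 2M + 6`; the lower bound on `M` leaves room
  -- for the labels and shifts.
  refine ⟨Nat.card Q * Nat.card Q * Nat.card Γ, Nat.card Q + Nat.card Γ, ?_, ?_⟩
  · have := Nat.card_pos (α := Q)
    have := Nat.card_pos (α := Γ)
    positivity
  intro M d hM hd
  obtain ⟨c, c0, c2, cs⟩ := exists_surjective_labelling Γ (N := 2 * M + 6) (by omega)
  obtain ⟨l, li, l1, lg⟩ := exists_injective_shift hg (N := 2 * M + 6) (by omega)
  let D : VoltageData G Q Γ (2 * M + 6) :=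
    ⟨i₀, j, k, hj, hk, φ, x, g, h, hx, hg, hh, hgh, c, c0, c2, cs, l, li, l1, lg⟩
  have hcls : ∀ τ : Equiv.Perm (Fin M), conjClassOf (D.subgroup (rigidPerm τ)) ∈
      freeSymmetryClasses (Monoid.CoprodI G) Γ d := by
    intro τ
    obtain ⟨h1, h2, h3, h4⟩ := D.isFreeWithSymmetry_subgroup hφ (isRigidPerm_rigidPerm τ)
    refine ⟨_, ⟨h1, h2, h3.trans (le_trans (le_of_eq ?_) hd), h4⟩, rfl⟩
    ring
  have hinj : Function.Injective fun τ : Equiv.Perm (Fin M) =>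
      conjClassOf (D.subgroup (rigidPerm τ)) := fun τ τ' hττ =>
    rigidPerm_injective
      (D.eq_of_conjClassOf_eq (isRigidPerm_rigidPerm τ) (isRigidPerm_rigidPerm τ') hττ)
  have hfin := (freeSymmetryClasses_finite_and_ncard_le (G := G) Γ d).1
  calc M.factorial = (Set.range fun τ : Equiv.Perm (Fin M) =>
        conjClassOf (D.subgroup (rigidPerm τ))).ncard := by
        rw [← Set.image_univ, Set.ncard_image_of_injective _ hinj, Set.ncard_univ, Nat.card_perm,
          Nat.card_fin]
    _ ≤ _ := Set.ncard_le_ncard (Set.range_subset_iff.mpr hcls) hfin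

end Existence

/-! ### Factorial estimates and the conclusion -/

section Growth

open Real Filter

/-- With `m = d / C ≥ d / (2C)` and `m! ≥ (m / e) ^ m`, it suffices that `log m - 1 ≥ (log d) / 2`,
which holds once `d ≥ (2 C e)²`. -/
theorem exp_le_factorial {C : ℕ} (hC : 0 < C) :
    ∃ B : ℝ, 0 < B ∧ ∃ M : ℕ, ∀ d : ℕ, M ≤ d →
      exp (B * d * log d) ≤ ((d / C).factorial : ℝ) := by
  have hC' : (0 : ℝ) < C := Nat.cast_pos.mpr hC
  refine ⟨1 / (4 * C), by positivity, ?_⟩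
  obtain ⟨M, hM⟩ := exists_nat_ge (max ((2 * C * exp 1) ^ 2) 1)
  refine ⟨max M (2 * C), fun d hd => ?_⟩
  have hdM : (M : ℝ) ≤ d := Nat.cast_le.mpr (le_of_max_le_left hd)
  have hd2 : (2 * C : ℝ) ≤ d := by exact_mod_cast le_of_max_le_right hd
  have hd1 : (1 : ℝ) ≤ d := (le_max_right _ _).trans (hM.trans hdM)
  have hd0 : (0 : ℝ) < d := by linarith
  have hsq : (2 * C * exp 1) ^ 2 ≤ (d : ℝ) := (le_max_left _ _).trans (hM.trans hdM)
  set m : ℕ := d / C with hm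
  have hm_ge : (d : ℝ) / (2 * C) ≤ m := by
    have h1 : (d : ℝ) / C < m + 1 := by
      rw [div_lt_iff₀ hC']
      have h2 : d < (m + 1) * C := by
        rw [hm, mul_comm]
        exact Nat.lt_mul_div_succ d hC
      exact_mod_cast h2
    have h3 : (1 : ℝ) ≤ d / (2 * C) := by
      rw [le_div_iff₀ (by positivity)]
      linarith
    have h4 : (d : ℝ) / C = d / (2 * C) + d / (2 * C) := by field_simp; norm_num
    linarith
  have hm_pos : (0 : ℝ) < m := lt_of_lt_of_le (by positivity) hm_ge
  have hlog_d : 0 ≤ log d := log_nonneg hd1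
  have hlog : log d / 2 ≤ log m - 1 := by
    have h1 : log (2 * C * exp 1) ≤ log d / 2 := by
      have := log_le_log (by positivity) hsq
      rw [log_pow] at this
      push_cast at this
      linarith
    have h2 : log ((d : ℝ) / (2 * C)) ≤ log m := log_le_log (by positivity) hm_ge
    rw [log_div (by positivity) (by positivity)] at h2
    rw [log_mul (by positivity) (by positivity), log_exp] at h1
    linarith
  have hfac : exp (m * log m - m) ≤ (m.factorial : ℝ) := by
    have h1 := pow_div_factorial_le_exp (x := (m : ℝ)) hm_pos.le m
    rw [div_le_iff₀ (by positivity)] at h1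
    rw [exp_sub, mul_comm (m : ℝ), exp_mul, exp_log hm_pos, rpow_natCast,
      div_le_iff₀ (exp_pos _), mul_comm]
    exact h1
  refine le_trans (exp_le_exp.mpr ?_) hfac
  calc 1 / (4 * C) * d * log d = (d / (2 * C)) * (log d / 2) := by ring
    _ ≤ m * (log m - 1) := mul_le_mul hm_ge hlog (by positivity) hm_pos.le
    _ = _ := by ring

end Growth

theorem factorial_pow_mul_le_exp (k : ℕ) {d : ℕ} (hd : 1 ≤ d) :
    ((d.factorial ^ k * d : ℕ) : ℝ) ≤ Real.exp ((k + 1 : ℕ) * d * Real.log d) := by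
  have hd0 : (0 : ℝ) < d := by exact_mod_cast hd
  have h1 : d.factorial ^ k * d ≤ d ^ ((k + 1) * d) := by
    calc d.factorial ^ k * d ≤ (d ^ d) ^ k * d ^ d :=
          Nat.mul_le_mul (Nat.pow_le_pow_left (Nat.factorial_le_pow d) k)
            (Nat.le_self_pow (by omega) d)
      _ = d ^ ((k + 1) * d) := by rw [← pow_mul, ← pow_add]; ring_nf
  calc ((d.factorial ^ k * d : ℕ) : ℝ) ≤ ((d ^ ((k + 1) * d) : ℕ) : ℝ) := by exact_mod_cast h1
    _ = Real.exp ((k + 1 : ℕ) * d * Real.log d) := by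
        rw [mul_comm _ (Real.log d), Real.exp_mul, Real.exp_log hd0, Nat.cast_pow,
          ← Real.rpow_natCast]
        push_cast
        rfl

theorem mainTheorem2 {ι : Type*} [Finite ι] [Nontrivial ι]
    (G : ι → Type*) [∀ i, Group (G i)] [∀ i, IsCyclic (G i)] [∀ i, Nontrivial (G i)]
    (hT : ¬ (Nat.card ι = 2 ∧ ∀ i, Nat.card (G i) = 2))
    (Γ : Type*) [Group Γ] [Finite Γ] :
    (∀ d : ℕ, (freeSymmetryClasses (Monoid.CoprodI G) Γ d).Finite) ∧
    (∃ A B : ℝ, 1 < A ∧ 0 < B ∧ ∃ M : ℕ, ∀ d : ℕ, M ≤ d →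
      A ^ (B * d * Real.log d) ≤ ((freeSymmetryClasses (Monoid.CoprodI G) Γ d).ncard : ℝ)) ∧
    (∃ C D : ℝ, 1 < C ∧ 0 < D ∧ ∃ M : ℕ, ∀ d : ℕ, M ≤ d →
      ((freeSymmetryClasses (Monoid.CoprodI G) Γ d).ncard : ℝ) ≤ C ^ (D * d * Real.log d)) ∧
    HasGrowthTypeSelfPow
      (fun d => ((freeSymmetryClasses (Monoid.CoprodI G) Γ d).ncard : ℝ)) := by
  obtain ⟨C, M₀, hC, hlow⟩ := exists_factorial_le_ncard G hT Γ
  -- Taking `M = d / (8C)`, the index bound `C (2M + 6)` is at most `8 C M ≤ d` as soon as `M ≥ 1`.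
  obtain ⟨B, hB, M, hfac⟩ := exp_le_factorial (C := 8 * C) (by omega)
  have hlower : ∀ d : ℕ, max M (8 * C * (M₀ + 1)) ≤ d → Real.exp (B * d * Real.log d) ≤
      ((freeSymmetryClasses (Monoid.CoprodI G) Γ d).ncard : ℝ) := by
    intro d hd
    have hd2 : 8 * C * (M₀ + 1) ≤ d := le_of_max_le_right hd
    refine (hfac d (le_of_max_le_left hd)).trans (Nat.cast_le.mpr (hlow _ d ?_ ?_))
    · rw [Nat.le_div_iff_mul_le (by omega)]
      nlinarith
    · have h1 : 8 * C * (d / (8 * C)) ≤ d := Nat.mul_div_le d (8 * C)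
      nlinarith
  have hupper : ∀ d : ℕ, 1 ≤ d →
      ((freeSymmetryClasses (Monoid.CoprodI G) Γ d).ncard : ℝ) ≤
        Real.exp ((Nat.card ι + 1 : ℕ) * d * Real.log d) := fun d hd =>
    (Nat.cast_le.mpr (freeSymmetryClasses_finite_and_ncard_le Γ d).2).trans
      (factorial_pow_mul_le_exp _ hd)
  have hD : (0 : ℝ) < (Nat.card ι + 1 : ℕ) := by positivity
  have hrpow : ∀ (b : ℝ) (d : ℕ), 1 ≤ d →
      (d : ℝ) ^ (b * d) = Real.exp (b * d * Real.log d) := by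
    intro b d hd
    rw [Real.rpow_def_of_pos (by exact_mod_cast hd), mul_comm]
  refine ⟨fun d => (freeSymmetryClasses_finite_and_ncard_le Γ d).1,
    ⟨Real.exp 1, B, Real.one_lt_exp_iff.mpr one_pos, hB, max M (8 * C * (M₀ + 1)),
      fun d hd => ?_⟩,
    ⟨Real.exp 1, (Nat.card ι + 1 : ℕ), Real.one_lt_exp_iff.mpr one_pos, hD, 1, fun d hd => ?_⟩,
    1, B, 1, (Nat.card ι + 1 : ℕ), one_pos, hB, one_pos, hD,
    max 1 (max M (8 * C * (M₀ + 1))), fun d hd => ?_⟩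
  · rw [Real.exp_one_rpow]
    exact hlower d hd
  · rw [Real.exp_one_rpow]
    exact hupper d hd
  · have hd1 : 1 ≤ d := le_of_max_le_left hd
    rw [one_mul, one_mul, hrpow _ d hd1, hrpow _ d hd1]
    exact ⟨hlower d (le_of_max_le_right hd), hupper d hd1⟩
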